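/- Consider nonempty words over the two-letter alphabet $\{l,r\}$ as finite structures: a word $w$ has its positions as universe, with the linear order $<$ of positions and unary predicates $P_l,P_r$ for the positions carrying the letters $l$ and $r$. First-order formulas are over the vocabulary $\{<,P_l,P_r\}$ with equality, and are built from atomic formulas with $\neg,\wedge,\vee,\exists,\forall$. The size of a formula is defined by giving size $1$ to every atomic formula, adding $1$ for each negation and each quantifier, and giving $\psi\wedge\theta$ and $\psi\vee\theta$ the sum of the sizes of $\psi$ and $\theta$ plus $1$. Let $\mathrm{FO}[n]$ be the set of first-order sentences of size at most $n$. For a sentence $\varphi$ let $\mu(\varphi)$ be the least length of a nonempty word satisfying $\varphi$, with $\mu(\varphi)=0$ if there is none, and let $\mathrm{LS}(\mathrm{FO}[n])=\max\{\mu(\varphi)\mid\varphi\in\mathrm{FO}[n]\}$. Let $\mathrm{tower}(0)=1$, $\mathrm{tower}(m+1)=2^{\mathrm{tower}(m)}$ for $m\in\mathbb N$, and $\mathrm{twr}(x)=\mathrm{tower}(\lceil x\rceil)$ for real $x\ge 0$. There is an integer $c\ge 1$ such that, for arbitrarily large $n\in\mathbb N$, $$\mathrm{LS}(\mathrm{FO}[n])\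 \ge\ \mathrm{twr}\bigl(\sqrt[3]{n/c}\bigr).$$ Moreover, there is a constant $C$ such that for every integer $i\ge 1$ there is a first-order sentence $\varphi_i$ of size at most $C\,i^3$ that is satisfied by some nonempty word, but only by words of length at least $\mathrm{twr}(i)$. -/

import Mathlib

namespace WordLogic

/-- The two-letter alphabet `Σ = {l, r}`. -/
inductive Letter where
  | l : Letter
  | r : Letter

/-- First-order formulas in the vocabulary `{<, P_l, P_r}` (with equality), whose free variables
are among `x_0, …, x_{k-1}`. A quantifier in a formula with `k` free variables binds `x_k`. -/
inductive Formula : ℕ → Type where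
  | lt {k : ℕ} (x y : Fin k) : Formula k
  | eq {k : ℕ} (x y : Fin k) : Formula k
  | pred {k : ℕ} (a : Letter) (x : Fin k) : Formula k
  | neg {k : ℕ} (φ : Formula k) : Formula k
  | and {k : ℕ} (φ ψ : Formula k) : Formula k
  | or {k : ℕ} (φ ψ : Formula k) : Formula k
  | ex {k : ℕ} (φ : Formula (k + 1)) : Formula k
  | all {k : ℕ} (φ : Formula (k + 1)) : Formula k

/-- A sentence is a formula without free variables. -/
abbrev Sentence : Type := Formula 0

/-- The size `sz(φ)` of a formula. -/
def Formula.size : {k : ℕ} → Formula k → ℕ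
  | _, .lt _ _ => 1
  | _, .eq _ _ => 1
  | _, .pred _ _ => 1
  | _, .neg φ => φ.size + 1
  | _, .and φ ψ => φ.size + ψ.size + 1
  | _, .or φ ψ => φ.size + ψ.size + 1
  | _, .ex φ => φ.size + 1
  | _, .all φ => φ.size + 1

/-- Satisfaction in the word model of `w`: the universe is the set of positions of `w` with its
linear order, and `P_a` holds at the positions that carry the letter `a`. -/
def Formula.Realize (w : List Letter) : {k : ℕ} → Formula k → (Fin k → Fin w.length) → Prop
  | _, .lt x y, v => v x < v y
  | _, .eq x y, v => v x = v y
  | _, .pred a x, v => w.get (v x) = a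
  | _, .neg φ, v => ¬ φ.Realize w v
  | _, .and φ ψ, v => φ.Realize w v ∧ ψ.Realize w v
  | _, .or φ ψ, v => φ.Realize w v ∨ ψ.Realize w v
  | _, .ex φ, v => ∃ p : Fin w.length, φ.Realize w (Fin.snoc v p)
  | _, .all φ, v => ∀ p : Fin w.length, φ.Realize w (Fin.snoc v p)

/-- `w ⊨ φ`, where `w ∈ Σ⁺` is a nonempty word and `φ` is a sentence. -/
def Models (w : List Letter) (φ : Sentence) : Prop :=
  w ≠ [] ∧ φ.Realize w Fin.elim0

/-- The minimal length `μ(φ)` of a model of `φ`; it is `0` if `φ` has no models. -/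
noncomputable def minLength (φ : Sentence) : ℕ :=
  sInf {m : ℕ | ∃ w : List Letter, Models w φ ∧ w.length = m}

/-- The size `n` fragment `FO[n]`: the sentences of size at most `n`. -/
def FO (n : ℕ) : Set Sentence := {φ | φ.size ≤ n}

/-- The Löwenheim-Skolem number `LS(L) = max {μ(φ) | φ ∈ L}`. Whenever `LS L` is positive, the
set is nonempty and bounded, so that the supremum is the maximum. -/
noncomputable def LS (L : Set Sentence) : ℕ := sSup (minLength '' L)

/-- The exponential tower function on the natural numbers. -/
def tower : ℕ → ℕ
  | 0 => 1
  | n + 1 => 2 ^ tower n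

/-- The extension of the exponential tower function to nonnegative reals. -/
noncomputable def twr (x : ℝ) : ℕ := tower ⌈x⌉₊

end WordLogic

/-! A set of rank `k` (an element of `PowerType k`, of which there are `tower k`) is coded by a node
`l r^k` followed by codes of its elements. The scope of a node of level `k + 1` runs to the next
node of at least that level or to the end of the word. Every position thus has a `value` in any
word, and no axioms on well-formed codes are needed. `IsFull w i` says that at each level up to `i`
the coded sets include the empty set and are closed under inserting a single coded element. By
finiteness every set of rank `i` is then the value of a position, whence `tower i ≤ w.length`. The
size bound rests on `definable_value_eq`: equality at level `m + 1` uses equality at level `m` only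
once, so its size is a sum of linear terms, hence quadratic. `definable_isFull` adds boundedly many
such formulas per level, hence is cubic. The code of the full set of rank `i + 1` is a model
(`exists_isFull`). -/

namespace WordLogic

/-! ### Definability with a bound on the size of the formula -/

/-- The property `P` of words with an assignment is defined by a formula of size at most `s`. -/
def DefinableIn (s k : ℕ) (P : ∀ w : List Letter, (Fin k → Fin w.length) → Prop) : Prop :=
  ∃ φ : Formula k, φ.size ≤ s ∧ ∀ w v, φ.Realize w v ↔ P w v

namespace DefinableIn

variable {s t k : ℕ} {P Q : ∀ w : List Letter, (Fin k → Fin w.length) → Prop}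

theorem mono (h : DefinableIn s k P) (hst : s ≤ t) : DefinableIn t k P :=
  let ⟨φ, hs, hφ⟩ := h
  ⟨φ, hs.trans hst, hφ⟩

theorem congr (h : DefinableIn s k P) (hPQ : ∀ w v, P w v ↔ Q w v) : DefinableIn s k Q :=
  let ⟨φ, hs, hφ⟩ := h
  ⟨φ, hs, fun w v => (hφ w v).trans (hPQ w v)⟩

theorem lt (x y : Fin k) : DefinableIn 1 k fun _ v => v x < v y :=
  ⟨.lt x y, le_rfl, fun _ _ => Iff.rfl⟩

theorem eq (x y : Fin k) : DefinableIn 1 k fun _ v => v x = v y :=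
  ⟨.eq x y, le_rfl, fun _ _ => Iff.rfl⟩

theorem letter (a : Letter) (x : Fin k) : DefinableIn 1 k fun w v => w.get (v x) = a :=
  ⟨.pred a x, le_rfl, fun _ _ => Iff.rfl⟩

theorem not (h : DefinableIn s k P) : DefinableIn (s + 1) k fun w v => ¬ P w v :=
  let ⟨φ, hs, hφ⟩ := h
  ⟨.neg φ, Nat.succ_le_succ hs, fun w v => not_congr (hφ w v)⟩

theorem and (h : DefinableIn s k P) (h' : DefinableIn t k Q) :
    DefinableIn (s + t + 1) k fun w v => P w v ∧ Q w v :=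
  let ⟨φ, hs, hφ⟩ := h
  let ⟨ψ, ht, hψ⟩ := h'
  ⟨.and φ ψ, Nat.succ_le_succ (Nat.add_le_add hs ht), fun w v => and_congr (hφ w v) (hψ w v)⟩

theorem or (h : DefinableIn s k P) (h' : DefinableIn t k Q) :
    DefinableIn (s + t + 1) k fun w v => P w v ∨ Q w v :=
  let ⟨φ, hs, hφ⟩ := h
  let ⟨ψ, ht, hψ⟩ := h'
  ⟨.or φ ψ, Nat.succ_le_succ (Nat.add_le_add hs ht), fun w v => or_congr (hφ w v) (hψ w v)⟩

theorem imp (h : DefinableIn s k P) (h' : DefinableIn t k Q) :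
    DefinableIn (s + t + 2) k fun w v => P w v → Q w v :=
  ((h.not.or h').mono (by omega)).congr fun _ _ => imp_iff_not_or.symm

/-- The bound variable is the last one, so `Fin.init v` is the assignment outside the quantifier. -/
theorem ex {R : ∀ w : List Letter, (Fin k → Fin w.length) → Fin w.length → Prop}
    (h : DefinableIn s (k + 1) fun w v => R w (Fin.init v) (v (Fin.last k))) :
    DefinableIn (s + 1) k fun w v => ∃ p, R w v p := by
  obtain ⟨φ, hs, hφ⟩ := h
  refine ⟨.ex φ, Nat.succ_le_succ hs, fun w v => exists_congr fun p => ?_⟩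
  refine (hφ w _).trans ?_
  beta_reduce
  rw [Fin.init_snoc, Fin.snoc_last]

theorem all {R : ∀ w : List Letter, (Fin k → Fin w.length) → Fin w.length → Prop}
    (h : DefinableIn s (k + 1) fun w v => R w (Fin.init v) (v (Fin.last k))) :
    DefinableIn (s + 1) k fun w v => ∀ p, R w v p := by
  obtain ⟨φ, hs, hφ⟩ := h
  refine ⟨.all φ, Nat.succ_le_succ hs, fun w v => forall_congr' fun p => ?_⟩
  refine (hφ w _).trans ?_
  beta_reduce
  rw [Fin.init_snoc, Fin.snoc_last]

end DefinableIn

/-! ### Words as codes of iterated sets -/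

/-- The iterated power sets of a one-point type. -/
def PowerType : ℕ → Type
  | 0 => Unit
  | k + 1 => Set (PowerType k)

instance finite_powerType : ∀ k, Finite (PowerType k)
  | 0 => inferInstanceAs (Finite Unit)
  | k + 1 =>
    have := finite_powerType k
    inferInstanceAs (Finite (Set (PowerType k)))

theorem card_powerType : ∀ k, Nat.card (PowerType k) = tower k
  | 0 => Nat.card_unique (α := Unit)
  | k + 1 => by
    have := Fintype.ofFinite (PowerType k)
    have h := card_powerType k
    rw [Nat.card_eq_fintype_card] at h
    change Nat.card (Set (PowerType k)) = 2 ^ tower k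
    classical
    rw [Nat.card_eq_fintype_card, Fintype.card_set, h]

/-- The word starts with a node of level at least `k`, that is, with `l r^k`. -/
def StartsNode (k : ℕ) (w : List Letter) : Prop :=
  Letter.l :: List.replicate k Letter.r <+: w

/-- The position `z` is a node of level `k` in the scope of the node `x` of level above `k`. -/
def IsChild (w : List Letter) (k x z : ℕ) : Prop :=
  x < z ∧ StartsNode k (w.drop z) ∧ ∀ u, x < u → u ≤ z → ¬ StartsNode (k + 1) (w.drop u)

/-- The iterated set that is coded at a position. -/
def value (w : List Letter) : (k : ℕ) → ℕ → PowerType k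
  | 0, _ => ()
  | k + 1, x => {t : PowerType k | ∃ z, IsChild w k x z ∧ value w k z = t}

theorem StartsNode.lt_length {w : List Letter} {k x : ℕ} (h : StartsNode k (w.drop x)) :
    x < w.length := by
  by_contra! hx
  rw [List.drop_eq_nil_of_le hx] at h
  simp [StartsNode] at h

theorem IsChild.lt_length {w : List Letter} {k x z : ℕ} (h : IsChild w k x z) : z < w.length :=
  h.2.1.lt_length

theorem StartsNode.mono {w : List Letter} {j k : ℕ} (h : StartsNode k w) (hjk : j ≤ k) :
    StartsNode j w := by
  obtain ⟨m, rfl⟩ := Nat.exists_eq_add_of_le hjk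
  rw [StartsNode, List.replicate_add, ← List.cons_append] at h
  exact (List.prefix_append _ _).trans h

/-- Every iterated set of rank at most `i` is coded in the word, as a closure condition. -/
def IsFull (w : List Letter) : ℕ → Prop
  | 0 => ∃ x : Fin w.length, StartsNode 0 (w.drop x)
  | k + 1 => IsFull w k ∧
      (∃ x : Fin w.length, StartsNode (k + 1) (w.drop x) ∧
        ∀ z : Fin w.length, ¬ IsChild w k x z) ∧
      ∀ x z : Fin w.length, StartsNode (k + 1) (w.drop x) → StartsNode k (w.drop z) →
        ∃ y : Fin w.length, StartsNode (k + 1) (w.drop y) ∧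
          (∀ u : Fin w.length, IsChild w k y u → value w k u = value w k z ∨
            ∃ v : Fin w.length, IsChild w k x v ∧ value w k u = value w k v) ∧
          ∀ u : Fin w.length, u = z ∨ IsChild w k x u →
            ∃ v : Fin w.length, IsChild w k y v ∧ value w k u = value w k v

theorem IsFull.exists_value {w : List Letter} :
    ∀ {i : ℕ}, IsFull w i → ∀ t : PowerType i,
      ∃ x : Fin w.length, StartsNode i (w.drop x) ∧ value w i x = t
  | 0, h, t => let ⟨x, hx⟩ := h; ⟨x, hx, rfl⟩
  | k + 1, ⟨hk, ⟨x, hx, hx'⟩, hins⟩, t => by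
    have ih := hk.exists_value
    -- A finite set arises from the empty set by successive insertions, which are exactly the two
    -- closure conditions.
    induction t, Set.toFinite (show Set (PowerType k) from t) using Set.Finite.induction_on with
    | empty =>
      refine ⟨x, hx, Set.eq_empty_of_forall_notMem ?_⟩
      rintro t ⟨z, hz, -⟩
      exact hx' ⟨z, hz.lt_length⟩ hz
    | @insert a t _ _ IH =>
      obtain ⟨x, hx, hxt⟩ := IH
      obtain ⟨z, hz, rfl⟩ := ih a
      obtain ⟨y, hy, h1, h2⟩ := hins x z hx hz
      refine ⟨y, hy, Set.ext fun b => ⟨?_, ?_⟩⟩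
      · rintro ⟨u, hu, rfl⟩
        rcases h1 ⟨u, hu.lt_length⟩ hu with h | ⟨v, hv, h⟩
        · exact Or.inl h
        · refine Or.inr ?_
          rw [← hxt]
          exact ⟨v, hv, h.symm⟩
      · rintro (rfl | hb)
        · obtain ⟨v, hv, h⟩ := h2 z (Or.inl rfl)
          exact ⟨v, hv, h.symm⟩
        · rw [← hxt] at hb
          obtain ⟨u, hu, rfl⟩ := hb
          obtain ⟨v, hv, h⟩ := h2 ⟨u, hu.lt_length⟩ (Or.inr hu)
          exact ⟨v, hv, h.symm⟩

theorem IsFull.tower_le_length {w : List Letter} {i : ℕ} (h : IsFull w i) :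
    tower i ≤ w.length := by
  rw [← card_powerType, ← Nat.card_fin w.length]
  exact Nat.card_le_card_of_surjective (fun x : Fin w.length => value w i x) fun t =>
    let ⟨x, _, hx⟩ := h.exists_value t
    ⟨x, hx⟩

/-- Used for the model: if all sets of ranks up to `i` are coded, so are the empty set and every
insertion. -/
theorem isFull_of_forall {w : List Letter} {i : ℕ}
    (h : ∀ k ≤ i, ∀ t : PowerType k,
      ∃ x : Fin w.length, StartsNode k (w.drop x) ∧ value w k x = t) : IsFull w i := by
  induction i with
  | zero => exact let ⟨x, hx, _⟩ := h 0 le_rfl (); ⟨x, hx⟩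
  | succ k ih =>
    refine ⟨ih fun j hj => h j (by omega), ?_, fun x z _ _ => ?_⟩
    · obtain ⟨x, hx, hv⟩ := h (k + 1) le_rfl (∅ : Set (PowerType k))
      refine ⟨x, hx, fun z hz => ?_⟩
      have : value w k z ∈ (show Set (PowerType k) from value w (k + 1) x) := ⟨z, hz, rfl⟩
      rw [hv] at this
      exact this
    · obtain ⟨y, hy, hv⟩ := h (k + 1) le_rfl
        (insert (value w k z) (value w (k + 1) x) : Set (PowerType k))
      refine ⟨y, hy, fun u hu => ?_, fun u hu => ?_⟩
      · have : value w k u ∈ (show Set (PowerType k) from value w (k + 1) y) := ⟨u, hu, rfl⟩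
        rw [hv] at this
        rcases this with h | ⟨v, hv, h⟩
        · exact Or.inl h
        · exact Or.inr ⟨⟨v, hv.lt_length⟩, hv, h.symm⟩
      · have : value w k u ∈ (show Set (PowerType k) from value w (k + 1) y) := by
          rw [hv]
          rcases hu with rfl | hu
          · exact Or.inl rfl
          · exact Or.inr ⟨u, hu, rfl⟩
        obtain ⟨v, hv, h⟩ := this
        exact ⟨⟨v, hv.lt_length⟩, hv, h.symm⟩

/-! ### Defining formulas -/

theorem definable_succ {k : ℕ} (x y : Fin k) :
    DefinableIn 7 k fun _ v => (v y : ℕ) = v x + 1 := by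
  refine ((DefinableIn.lt x y).and (DefinableIn.ex (R := fun _ v p => v x < p ∧ p < v y)
    ((DefinableIn.lt x.castSucc (Fin.last k)).and
      (DefinableIn.lt (Fin.last k) y.castSucc))).not).congr fun w v => ?_
  constructor
  · rintro ⟨h1, h2⟩
    by_contra h3
    rw [Fin.lt_def] at h1
    exact h2 ⟨⟨v x + 1, by omega⟩, Fin.lt_def.2 (by simp), Fin.lt_def.2 (by simp; omega)⟩
  · intro h
    refine ⟨Fin.lt_def.2 (by omega), ?_⟩
    rintro ⟨p, h1, h2⟩
    rw [Fin.lt_def] at h1 h2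
    omega

/-- Each further letter costs one quantifier, one successor formula, one atom and two conjunctions,
11 in all. -/
theorem definable_replicate (m : ℕ) {k : ℕ} (x : Fin k) :
    DefinableIn (11 * m + 1) k fun w v => List.replicate m Letter.r <+: w.drop (v x + 1) := by
  induction m generalizing k with
  | zero => exact (DefinableIn.eq x x).congr fun w v => by simp
  | succ m ih =>
    refine ((DefinableIn.ex (R := fun w v p => (p : ℕ) = v x + 1 ∧ w.get p = Letter.r ∧
      List.replicate m Letter.r <+: w.drop (p + 1)) ((definable_succ x.castSucc (Fin.last k)).and
        ((DefinableIn.letter Letter.r (Fin.last k)).and (ih (Fin.last k))))).mono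
          (by omega)).congr fun w v => ?_
    constructor
    · rintro ⟨p, h1, h2, h3⟩
      rw [← h1, List.drop_eq_getElem_cons p.2, List.replicate_succ, List.cons_prefix_cons]
      exact ⟨h2.symm, h3⟩
    · intro h
      have hlt : v x + 1 < w.length := by
        by_contra! hx
        rw [List.drop_eq_nil_of_le hx] at h
        simp at h
      rw [List.drop_eq_getElem_cons hlt, List.replicate_succ, List.cons_prefix_cons] at h
      exact ⟨⟨v x + 1, hlt⟩, rfl, h.1.symm, h.2⟩

theorem definable_startsNode (m : ℕ) {k : ℕ} (x : Fin k) :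
    DefinableIn (11 * m + 3) k fun w v => StartsNode m (w.drop (v x)) := by
  refine (((DefinableIn.letter Letter.l x).and (definable_replicate m x)).mono
    (by omega)).congr fun w v => ?_
  rw [StartsNode, List.drop_eq_getElem_cons (v x).2, List.cons_prefix_cons]
  exact and_congr_left' eq_comm

theorem definable_isChild (m : ℕ) {k : ℕ} (x z : Fin k) :
    DefinableIn (22 * m + 40) k fun w v => IsChild w m (v x) (v z) := by
  refine (((DefinableIn.lt x z).and ((definable_startsNode m z).and
    (DefinableIn.all (R := fun w v p => v x < p → ¬ v z < p → ¬ StartsNode (m + 1) (w.drop p))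
      ((DefinableIn.lt x.castSucc (Fin.last k)).imp
        ((DefinableIn.lt z.castSucc (Fin.last k)).not.imp
          (definable_startsNode (m + 1) (Fin.last k)).not))))).mono (by omega)).congr
            fun w v => ?_
  refine and_congr Iff.rfl (and_congr_right fun h => ⟨fun h u hu hz => ?_, fun h p hp hz => ?_⟩)
  · exact h ⟨u, hz.trans_lt (v z).2⟩ hu (not_lt.2 hz)
  · exact h p hp (not_lt.1 hz)

/-- Writing both inclusions separately would double the size at each level. Quantifying over the
ordered pairs `(x, y)` and `(y, x)` expresses both with one copy of the formula for level `m`; the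
rest is linear in `m`. -/
theorem definable_value_eq (m : ℕ) {k : ℕ} (x y : Fin k) :
    DefinableIn (100 * (m + 1) ^ 2) k fun w v => value w m (v x) = value w m (v y) := by
  induction m generalizing k with
  | zero => exact ((DefinableIn.eq x x).mono (by norm_num)).congr fun w v => iff_of_true rfl rfl
  | succ m ih =>
    have key : DefinableIn (100 * (m + 1 + 1) ^ 2) k fun w v => ∀ a b : Fin w.length,
        (a = v x ∧ b = v y) ∨ (a = v y ∧ b = v x) → ∀ c : Fin w.length, IsChild w m a c →
          ∃ d : Fin w.length, IsChild w m b d ∧ value w m c = value w m d := by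
      refine DefinableIn.mono (DefinableIn.all (DefinableIn.all (DefinableIn.imp
        (((DefinableIn.eq (Fin.last k).castSucc x.castSucc.castSucc).and
          (DefinableIn.eq (Fin.last (k + 1)) y.castSucc.castSucc)).or
        ((DefinableIn.eq (Fin.last k).castSucc y.castSucc.castSucc).and
          (DefinableIn.eq (Fin.last (k + 1)) x.castSucc.castSucc)))
        (DefinableIn.all ((definable_isChild m (Fin.last k).castSucc.castSucc
          (Fin.last (k + 2))).imp (DefinableIn.ex
            ((definable_isChild m (Fin.last (k + 1)).castSucc.castSucc (Fin.last (k + 3))).and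
              (ih (Fin.last (k + 2)).castSucc (Fin.last (k + 3))))))))))
        (by ring_nf; omega)
    refine key.congr fun w v => ⟨fun h => ?_, ?_⟩
    · have aux : ∀ a b : Fin w.length, (a = v x ∧ b = v y) ∨ (a = v y ∧ b = v x) →
          (show Set (PowerType m) from value w (m + 1) a) ⊆
            (show Set (PowerType m) from value w (m + 1) b) := by
        rintro a b hab t ⟨c, hc, rfl⟩
        obtain ⟨d, hd, hcd⟩ := h a b hab ⟨c, hc.lt_length⟩ hc
        exact ⟨d, hd, hcd.symm⟩
      exact Set.Subset.antisymm (aux _ _ (Or.inl ⟨rfl, rfl⟩)) (aux _ _ (Or.inr ⟨rfl, rfl⟩))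
    · intro h a b hab c hc
      have hab' : value w (m + 1) a = value w (m + 1) b := by
        rcases hab with ⟨rfl, rfl⟩ | ⟨rfl, rfl⟩
        exacts [h, h.symm]
      have : value w m c ∈ (show Set (PowerType m) from value w (m + 1) a) := ⟨c, hc, rfl⟩
      rw [hab'] at this
      obtain ⟨d, hd, hcd⟩ := this
      exact ⟨⟨d, hd.lt_length⟩, hd, hcd.symm⟩

/-- Each level adds three quadratic equality formulas and linear overhead. -/
theorem definable_isFull (i : ℕ) : DefinableIn (600 * (i + 1) ^ 3) 0 fun w _ => IsFull w i := by
  induction i with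
  | zero => exact (DefinableIn.ex (definable_startsNode 0 (Fin.last 0))).mono (by norm_num)
  | succ k ih =>
    have hins : DefinableIn (300 * (k + 1) ^ 2 + 200 * k + 300) 0 fun w _ =>
        ∀ x z : Fin w.length, StartsNode (k + 1) (w.drop x) → StartsNode k (w.drop z) →
        ∃ y : Fin w.length, StartsNode (k + 1) (w.drop y) ∧
          (∀ u : Fin w.length, IsChild w k y u → value w k u = value w k z ∨
            ∃ v : Fin w.length, IsChild w k x v ∧ value w k u = value w k v) ∧
          ∀ u : Fin w.length, u = z ∨ IsChild w k x u →
            ∃ v : Fin w.length, IsChild w k y v ∧ value w k u = value w k v := by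
      refine DefinableIn.mono (DefinableIn.all (DefinableIn.all (DefinableIn.imp
        (definable_startsNode (k + 1) (0 : Fin 2)) (DefinableIn.imp
          (definable_startsNode k (1 : Fin 2)) (DefinableIn.ex (DefinableIn.and
            (definable_startsNode (k + 1) (2 : Fin 3)) (DefinableIn.and
              (DefinableIn.all (DefinableIn.imp (definable_isChild k (2 : Fin 4) 3)
                (DefinableIn.or (definable_value_eq k (3 : Fin 4) 1)
                  (DefinableIn.ex (DefinableIn.and (definable_isChild k (0 : Fin 5) 4)
                    (definable_value_eq k (3 : Fin 5) 4))))))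
              (DefinableIn.all (DefinableIn.imp
                (DefinableIn.or (DefinableIn.eq (3 : Fin 4) 1) (definable_isChild k (0 : Fin 4) 3))
                (DefinableIn.ex (DefinableIn.and (definable_isChild k (2 : Fin 5) 4)
                  (definable_value_eq k (3 : Fin 5) 4)))))))))))) ?_
      omega
    have hempty : DefinableIn (40 * k + 100) 0 fun w _ =>
        ∃ x : Fin w.length, StartsNode (k + 1) (w.drop x) ∧
          ∀ z : Fin w.length, ¬ IsChild w k x z :=
      DefinableIn.mono (DefinableIn.ex (DefinableIn.and (definable_startsNode (k + 1) (0 : Fin 1))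
        (DefinableIn.all (definable_isChild k (0 : Fin 2) 1).not))) (by omega)
    exact (ih.and (hempty.and hins)).mono (by ring_nf; nlinarith)

/-! ### A model -/

/-- The word that codes an iterated set. -/
noncomputable def encode : (k : ℕ) → PowerType k → List Letter
  | 0, _ => [Letter.l]
  | k + 1, t => Letter.l :: (List.replicate (k + 1) Letter.r ++
      (Set.toFinite (show Set (PowerType k) from t)).toFinset.toList.flatMap (encode k))

theorem encode_succ (k : ℕ) (t : Set (PowerType k)) : encode (k + 1) t =
    Letter.l :: (List.replicate (k + 1) Letter.r ++
      (Set.toFinite t).toFinset.toList.flatMap (encode k)) := rfl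

/-- The letter `r` is not the first one. -/
def NotStartsR (v : List Letter) : Prop := ∀ v', v ≠ Letter.r :: v'

/-- No node of level at least `k` begins inside `y`. -/
def NoNode (k : ℕ) : List Letter → Prop
  | [] => True
  | a :: y => (∀ v, NotStartsR v → ¬ StartsNode k (a :: (y ++ v))) ∧ NoNode k y

theorem startsNode_encode : ∀ (k : ℕ) (t : PowerType k) (v : List Letter),
    StartsNode k (encode k t ++ v)
  | 0, _, v => by simp [StartsNode, encode]
  | k + 1, t, v => by
    rw [StartsNode, encode, List.cons_append, List.cons_prefix_cons, List.append_assoc]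
    exact ⟨rfl, List.prefix_append _ _⟩

theorem StartsNode.notStartsR {k : ℕ} {v : List Letter} (h : StartsNode k v) : NotStartsR v := by
  rintro v' rfl
  simp [StartsNode] at h

theorem notStartsR_nil : NotStartsR [] := fun _ => by simp

theorem notStartsR_encode (k : ℕ) (t : PowerType k) (v : List Letter) :
    NotStartsR (encode k t ++ v) := (startsNode_encode k t v).notStartsR

theorem notStartsR_flatMap (k : ℕ) (ss : List (PowerType k)) {v : List Letter}
    (hv : NotStartsR v) : NotStartsR (ss.flatMap (encode k) ++ v) := by
  cases ss with
  | nil => exact hv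
  | cons s ss =>
    rw [List.flatMap_cons, List.append_assoc]
    exact notStartsR_encode _ _ _

/-- An `r` right after a code could raise the level of its last node; excluding it fixes the levels.
-/
theorem not_replicate_prefix (k : ℕ) {v : List Letter} (hv : NotStartsR v) :
    ¬ List.replicate (k + 1) Letter.r <+: List.replicate k Letter.r ++ v := by
  rw [List.replicate_succ', List.prefix_append_right_inj]
  rintro ⟨v', rfl⟩
  exact hv v' rfl

theorem NoNode.mono {j k : ℕ} (hjk : j ≤ k) : ∀ {y : List Letter}, NoNode j y → NoNode k y
  | [], _ => trivial
  | _ :: _, h => ⟨fun v hv h' => h.1 v hv (h'.mono hjk), h.2.mono hjk⟩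

theorem NoNode.append {k : ℕ} {y' : List Letter} (h' : NoNode k y')
    (hy' : ∀ v, NotStartsR v → NotStartsR (y' ++ v)) :
    ∀ {y : List Letter}, NoNode k y → NoNode k (y ++ y')
  | [], _ => h'
  | a :: y, h => ⟨fun v hv => by
      change ¬ StartsNode k (a :: (y ++ y' ++ v))
      rw [List.append_assoc]
      exact h.1 _ (hy' v hv), NoNode.append h' hy' h.2⟩

theorem NoNode.replicate_append {k : ℕ} {y : List Letter} (h : NoNode k y) :
    ∀ m, NoNode k (List.replicate m Letter.r ++ y)
  | 0 => by simpa using h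
  | m + 1 => by
    rw [List.replicate_succ, List.cons_append]
    exact ⟨fun v _ h' => h'.notStartsR _ rfl, h.replicate_append m⟩

theorem noNode_flatMap {k j : ℕ} (h : ∀ t : PowerType k, NoNode j (encode k t)) :
    ∀ ss : List (PowerType k), NoNode j (ss.flatMap (encode k))
  | [] => trivial
  | s :: ss => by
    rw [List.flatMap_cons]
    exact (noNode_flatMap h ss).append (fun v hv => notStartsR_flatMap k ss hv) (h s)

theorem noNode_encode : ∀ (k : ℕ) (t : PowerType k), NoNode (k + 1) (encode k t)
  | 0, _ => ⟨fun v hv h => not_replicate_prefix 0 hv (List.cons_prefix_cons.1 h).2, trivial⟩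
  | k + 1, t => by
    refine ⟨fun v hv h => ?_, ?_⟩
    · rw [List.append_assoc] at h
      exact not_replicate_prefix (k + 1) (notStartsR_flatMap k _ hv) (List.cons_prefix_cons.1 h).2
    · exact ((noNode_flatMap (noNode_encode k) _).mono (Nat.le_succ _)).replicate_append _

/-- The head is itself a node of level `k`, so this sharper bound needs the tail. -/
theorem noNode_tail_encode : ∀ (k : ℕ) (t : PowerType k), NoNode k (encode k t).tail
  | 0, _ => trivial
  | k + 1, _ => (noNode_flatMap (noNode_encode k) _).replicate_append _

theorem NoNode.not_startsNode {k : ℕ} {v : List Letter} (hv : NotStartsR v) :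
    ∀ {y : List Letter}, NoNode k y → ∀ {n : ℕ}, n < y.length →
      ¬ StartsNode k (y.drop n ++ v)
  | _ :: _, h, 0, _ => h.1 v hv
  | _ :: _, h, n + 1, hn => by
    simpa using h.2.not_startsNode hv (by simpa using hn)

/-- The word is empty or starts with a node of level at least `k`. -/
def ClosesScope (k : ℕ) (v : List Letter) : Prop := v = [] ∨ StartsNode k v

theorem ClosesScope.notStartsR {k : ℕ} {v : List Letter} (h : ClosesScope k v) :
    NotStartsR v := by
  rcases h with rfl | h
  exacts [notStartsR_nil, h.notStartsR]

theorem closesScope_flatMap {k : ℕ} (ss : List (PowerType k)) {v : List Letter}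
    (hv : ClosesScope (k + 1) v) : ClosesScope k (ss.flatMap (encode k) ++ v) := by
  cases ss with
  | nil => exact hv.imp_right fun h => h.mono (Nat.le_succ k)
  | cons s ss =>
    rw [List.flatMap_cons, List.append_assoc]
    exact Or.inr (startsNode_encode _ _ _)

/-- The code of `t` occurs in `w` at `x`, and its scope ends where the code does. -/
def Occurs (w : List Letter) (k : ℕ) (t : PowerType k) (x : ℕ) : Prop :=
  ∃ v, w.drop x = encode k t ++ v ∧ ClosesScope k v

theorem Occurs.startsNode {w : List Letter} {k : ℕ} {t : PowerType k} {x : ℕ}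
    (h : Occurs w k t x) : StartsNode k (w.drop x) := by
  obtain ⟨v, hv, -⟩ := h
  rw [hv]
  exact startsNode_encode k t v

/-- Nodes inside a sequence of codes are the beginnings of these codes. -/
theorem exists_of_startsNode_flatMap {k : ℕ} {v : List Letter} (hv : NotStartsR v) :
    ∀ (ss : List (PowerType k)) {n : ℕ}, n < (ss.flatMap (encode k)).length →
      StartsNode k ((ss.flatMap (encode k) ++ v).drop n) →
      ∃ s ∈ ss, ∃ ss' : List (PowerType k),
        (ss.flatMap (encode k) ++ v).drop n = encode k s ++ (ss'.flatMap (encode k) ++ v)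
  | [], n, hn, _ => by simp at hn
  | s :: ss, n, hn, h => by
    rw [List.flatMap_cons, List.append_assoc] at h ⊢
    rw [List.flatMap_cons, List.length_append] at hn
    rcases lt_or_ge n (encode k s).length with hlt | hge
    · rcases n with _ | n
      · exact ⟨s, by simp, ss, rfl⟩
      · exfalso
        rw [List.drop_append_of_le_length hlt.le, ← List.drop_tail] at h
        refine (noNode_tail_encode k s).not_startsNode (notStartsR_flatMap k ss hv) ?_ h
        rw [List.length_tail]
        omega
    · obtain ⟨m, rfl⟩ := Nat.exists_eq_add_of_le hge
      rw [List.drop_append] at h ⊢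
      simp only [Nat.add_sub_cancel_left, List.drop_eq_nil_of_le hge, List.nil_append] at h ⊢
      obtain ⟨s', hs', ss', h'⟩ := exists_of_startsNode_flatMap hv ss (by omega) h
      exact ⟨s', List.mem_cons_of_mem _ hs', ss', h'⟩

theorem not_startsNode_of_drop_eq {w v : List Letter} {k x u : ℕ} {t : PowerType k}
    (h : w.drop x = encode k t ++ v) (hv : NotStartsR v) (hxu : x < u)
    (hu : u < x + (encode k t).length) : ¬ StartsNode k (w.drop u) := by
  obtain ⟨n, rfl⟩ := Nat.exists_eq_add_of_lt hxu
  have hn : n + 1 < (encode k t).length := by omega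
  rw [add_assoc, ← List.drop_drop, h, List.drop_append_of_le_length hn.le, ← List.drop_tail]
  exact (noNode_tail_encode k t).not_startsNode hv (by rw [List.length_tail]; omega)

/-- Splitting the list of elements at `s` locates its code. No node of level `k + 1` lies between,
since only the head of the outer code has that level. -/
theorem Occurs.exists_child {w : List Letter} {k : ℕ} {t : Set (PowerType k)} {x : ℕ}
    (h : Occurs w (k + 1) t x) {s : PowerType k} (hs : s ∈ t) :
    ∃ z, IsChild w k x z ∧ Occurs w k s z := by
  obtain ⟨v, hw, hv⟩ := h
  obtain ⟨p, q, hpq⟩ := List.append_of_mem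
    (show s ∈ (Set.toFinite t).toFinset.toList by simpa using hs)
  let y := Letter.l :: (List.replicate (k + 1) Letter.r ++ p.flatMap (encode k))
  have henc : encode (k + 1) t = y ++ (encode k s ++ q.flatMap (encode k)) := by
    simp [y, encode, hpq]
  have hdrop : w.drop (x + y.length) = encode k s ++ (q.flatMap (encode k) ++ v) := by
    rw [← List.drop_drop, hw, henc, List.append_assoc, List.drop_left, List.append_assoc]
  have hocc : Occurs w k s (x + y.length) := ⟨_, hdrop, closesScope_flatMap q hv⟩
  refine ⟨x + y.length, ⟨by simp [y], hocc.startsNode, fun u hxu hu => ?_⟩, hocc⟩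
  refine not_startsNode_of_drop_eq hw hv.notStartsR hxu ?_
  have hpos : 0 < (encode k s).length := by cases k <;> simp [encode]
  rw [henc, List.length_append, List.length_append]
  omega

/-- A child cannot lie past the code, where the word ends or a node closes the scope, nor in the
block of `r`s. It is therefore the head of an element's code. -/
theorem Occurs.of_isChild {w : List Letter} {k : ℕ} {t : Set (PowerType k)} {x z : ℕ}
    (h : Occurs w (k + 1) t x) (hz : IsChild w k x z) : ∃ s ∈ t, Occurs w k s z := by
  obtain ⟨v, hw, hv⟩ := h
  obtain ⟨hxz, hnode, hscope⟩ := hz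
  obtain ⟨n, rfl⟩ := Nat.exists_eq_add_of_lt hxz
  have hn : n + 1 < (encode (k + 1) t).length := by
    by_contra! hn
    have hend : w.drop (x + (encode (k + 1) t).length) = v := by
      rw [← List.drop_drop, hw, List.drop_left]
    rcases hv with rfl | hv
    · have := hnode.lt_length
      rw [List.drop_eq_nil_iff] at hend
      omega
    · exact hscope _ (by simp [encode]) (by omega) (hend ▸ hv)
  have hdrop : w.drop (x + n + 1) = (List.replicate (k + 1) Letter.r ++
      ((Set.toFinite t).toFinset.toList.flatMap (encode k) ++ v)).drop n := by
    rw [add_assoc, ← List.drop_drop, hw, encode_succ, List.cons_append, List.drop_succ_cons,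
      List.append_assoc]
  rw [hdrop] at hnode
  rcases lt_or_ge n (k + 1) with hlt | hge
  · rw [List.drop_append_of_le_length (by simpa using hlt.le), List.drop_replicate,
      show k + 1 - n = k - n + 1 by omega, List.replicate_succ] at hnode
    exact absurd rfl (hnode.notStartsR _)
  · obtain ⟨m, rfl⟩ := Nat.exists_eq_add_of_le hge
    have hm : (List.replicate (k + 1) Letter.r ++
        ((Set.toFinite t).toFinset.toList.flatMap (encode k) ++ v)).drop (k + 1 + m) =
          ((Set.toFinite t).toFinset.toList.flatMap (encode k) ++ v).drop m := by
      rw [← List.drop_drop, List.drop_left' (by simp)]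
    rw [hm] at hnode hdrop
    obtain ⟨s, hs, ss, hss⟩ := exists_of_startsNode_flatMap hv.notStartsR _ (by
      rw [encode_succ, List.length_cons, List.length_append, List.length_replicate] at hn
      omega) hnode
    exact ⟨s, by simpa using hs, _, hdrop.trans hss, closesScope_flatMap ss hv⟩

theorem Occurs.value_eq {w : List Letter} : ∀ {k : ℕ} {t : PowerType k} {x : ℕ},
    Occurs w k t x → value w k x = t
  | 0, _, _, _ => rfl
  | k + 1, t, x, h => by
    refine Set.ext fun s => ⟨?_, fun hs => ?_⟩
    · rintro ⟨z, hz, rfl⟩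
      obtain ⟨s, hs, hsz⟩ := h.of_isChild hz
      rwa [hsz.value_eq]
    · obtain ⟨z, hz, hsz⟩ := h.exists_child hs
      exact ⟨z, hz, hsz.value_eq⟩

theorem exists_isFull (i : ℕ) : ∃ w, IsFull w i := by
  refine ⟨encode (i + 1) (Set.univ : Set (PowerType i)), isFull_of_forall fun k hk t => ?_⟩
  generalize hw : encode (i + 1) (Set.univ : Set (PowerType i)) = w
  suffices h : ∃ x, Occurs w k t x by
    obtain ⟨x, hx⟩ := h
    exact ⟨⟨x, hx.startsNode.lt_length⟩, hx.startsNode, hx.value_eq⟩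
  -- Descent in rank: the full set of rank `k + 1` occurs, and every set of rank `k` is one of its
  -- elements.
  induction hk using Nat.decreasingInduction with
  | self =>
    have h : Occurs w (i + 1) (Set.univ : Set (PowerType i)) 0 := ⟨[], by simp [hw], Or.inl rfl⟩
    obtain ⟨z, -, hz⟩ := h.exists_child (Set.mem_univ t)
    exact ⟨z, hz⟩
  | of_succ k hk ih =>
    obtain ⟨x, hx⟩ := ih (Set.univ : Set (PowerType k))
    obtain ⟨z, -, hz⟩ := hx.exists_child (Set.mem_univ t)
    exact ⟨z, hz⟩

/-! ### Löwenheim-Skolem numbers -/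

theorem Formula.size_pos : ∀ {k : ℕ} (φ : Formula k), 0 < φ.size
  | _, .lt _ _ | _, .eq _ _ | _, .pred _ _ => Nat.one_pos
  | _, .neg _ | _, .and _ _ | _, .or _ _ | _, .ex _ | _, .all _ => Nat.succ_pos _

/-- This makes the supremum in `LS` bounded; an unbounded one would be `0` by convention. -/
theorem finite_size_le (n k : ℕ) : {φ : Formula k | φ.size ≤ n}.Finite := by
  induction n generalizing k with
  | zero =>
    refine Set.finite_empty.subset fun φ hφ => ?_
    exact absurd φ.size_pos (by simpa using hφ)
  | succ n ih =>
    have hL : Finite Letter := by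
      refine Finite.of_surjective (fun b : Bool => if b then Letter.l else Letter.r) ?_
      rintro (_ | _)
      exacts [⟨true, rfl⟩, ⟨false, rfl⟩]
    refine ((Set.finite_range fun p : Fin k × Fin k => Formula.lt p.1 p.2).union <|
      (Set.finite_range fun p : Fin k × Fin k => Formula.eq p.1 p.2).union <|
      (Set.finite_range fun p : Letter × Fin k => Formula.pred p.1 p.2).union <|
      ((ih k).image Formula.neg).union <|
      (Set.Finite.image2 Formula.and (ih k) (ih k)).union <|
      (Set.Finite.image2 Formula.or (ih k) (ih k)).union <|
      ((ih (k + 1)).image Formula.ex).union ((ih (k + 1)).image Formula.all)).subset ?_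
    intro φ hφ
    simp only [Set.mem_union, Set.mem_range, Set.mem_image, Set.mem_image2, Set.mem_ofPred_eq,
      Prod.exists]
    cases φ with
    | lt x y => exact .inl ⟨x, y, rfl⟩
    | eq x y => exact .inr <| .inl ⟨x, y, rfl⟩
    | pred a x => exact .inr <| .inr <| .inl ⟨a, x, rfl⟩
    | neg φ => exact .inr <| .inr <| .inr <| .inl ⟨φ, Nat.le_of_succ_le_succ hφ, rfl⟩
    | and φ ψ =>
      have h : φ.size + ψ.size + 1 ≤ n + 1 := hφ
      exact .inr <| .inr <| .inr <| .inr <| .inl ⟨φ, by omega, ψ, by omega, rfl⟩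
    | or φ ψ =>
      have h : φ.size + ψ.size + 1 ≤ n + 1 := hφ
      exact .inr <| .inr <| .inr <| .inr <| .inr <| .inl ⟨φ, by omega, ψ, by omega, rfl⟩
    | ex φ =>
      exact .inr <| .inr <| .inr <| .inr <| .inr <| .inr <| .inl
        ⟨φ, Nat.le_of_succ_le_succ hφ, rfl⟩
    | all φ =>
      exact .inr <| .inr <| .inr <| .inr <| .inr <| .inr <| .inr
        ⟨φ, Nat.le_of_succ_le_succ hφ, rfl⟩

theorem minLength_le_LS {n : ℕ} {φ : Sentence} (hφ : φ.size ≤ n) : minLength φ ≤ LS (FO n) :=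
  le_csSup ((finite_size_le n 0).image minLength).bddAbove ⟨φ, hφ, rfl⟩

/-- A model must exist because `sInf ∅ = 0`. -/
theorem le_minLength {φ : Sentence} {m : ℕ} (hφ : ∃ w, Models w φ)
    (h : ∀ w, Models w φ → m ≤ w.length) : m ≤ minLength φ := by
  obtain ⟨w, hw⟩ := hφ
  obtain ⟨w', hw', h'⟩ := Nat.sInf_mem
    (s := {m : ℕ | ∃ w : List Letter, Models w φ ∧ w.length = m}) ⟨_, w, hw, rfl⟩
  rw [minLength, ← h']
  exact h w' hw'

theorem tower_pos : ∀ i, 0 < tower i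
  | 0 => Nat.one_pos
  | i + 1 => Nat.pow_pos (n := tower i) Nat.two_pos

theorem exists_sentence_tower {i : ℕ} (hi : 1 ≤ i) : ∃ φ : Sentence, φ.size ≤ 4800 * i ^ 3 ∧
    (∃ w, Models w φ) ∧ ∀ w, Models w φ → tower i ≤ w.length := by
  obtain ⟨φ, hs, hφ⟩ := definable_isFull i
  refine ⟨φ, hs.trans ?_, ?_, fun w hw => ((hφ w _).1 hw.2).tower_le_length⟩
  · calc 600 * (i + 1) ^ 3 ≤ 600 * (2 * i) ^ 3 := by gcongr; omega
      _ = 4800 * i ^ 3 := by ring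
  · obtain ⟨w, hw⟩ := exists_isFull i
    refine ⟨w, ?_, (hφ w _).2 hw⟩
    rintro rfl
    exact absurd hw.tower_le_length (not_le.2 (tower_pos i))

end WordLogic

theorem corollary6 :
    (∃ c : ℕ, 0 < c ∧ ∀ N : ℕ, ∃ n : ℕ, N ≤ n ∧
      WordLogic.twr (((n : ℝ) / (c : ℝ)) ^ ((1 : ℝ) / 3)) ≤ WordLogic.LS (WordLogic.FO n)) ∧
    (∃ C : ℕ, ∀ i : ℕ, 1 ≤ i → ∃ φ : WordLogic.Sentence,
      φ.size ≤ C * i ^ 3 ∧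
      (∃ w : List WordLogic.Letter, WordLogic.Models w φ) ∧
      ∀ w : List WordLogic.Letter, WordLogic.Models w φ → WordLogic.tower i ≤ w.length) := by
  -- With this `n` the cube root of `n / c` is the integer `N + 1`, so the ceiling in `twr` loses
  -- nothing.
  refine ⟨⟨4800, by norm_num, fun N => ⟨4800 * (N + 1) ^ 3, ?_, ?_⟩⟩,
    4800, fun i hi => WordLogic.exists_sentence_tower hi⟩
  · calc N ≤ N + 1 := Nat.le_succ N
      _ ≤ (N + 1) ^ 3 := Nat.le_self_pow (by norm_num) _
      _ ≤ 4800 * (N + 1) ^ 3 := Nat.le_mul_of_pos_left _ (by norm_num)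
  · obtain ⟨φ, hs, hw, hφ⟩ := WordLogic.exists_sentence_tower (Nat.succ_pos N)
    have hroot : (((4800 * (N + 1) ^ 3 : ℕ) : ℝ) / ((4800 : ℕ) : ℝ)) ^ ((1 : ℝ) / 3)
        = ((N + 1 : ℕ) : ℝ) := by
      have : ((4800 * (N + 1) ^ 3 : ℕ) : ℝ) / ((4800 : ℕ) : ℝ) = ((N + 1 : ℕ) : ℝ) ^ 3 := by
        push_cast
        field_simp
      rw [this, ← Real.rpow_natCast, ← Real.rpow_mul (Nat.cast_nonneg _)]
      norm_num
    rw [WordLogic.twr, hroot, Nat.ceil_natCast]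
    exact (WordLogic.le_minLength hw hφ).trans (WordLogic.minLength_le_LS hs)
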